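/- Let $\mathbb U=\{z\in\mathbb C:|z|<1\}$ and let $\mathcal A$ be the class of functions analytic in $\mathbb U$ of the form $f(z)=z+\sum_{n\ge2}a_nz^n$. A function $h\in\mathcal A$ belongs to the class $\sigma$ of bi-univalent functions if $h$ is univalent in $\mathbb U$ and its inverse at the origin continues analytically to a univalent function on $\mathbb U$, again denoted $h^{-1}$. For functions $F,G$ analytic in $\mathbb U$, $F\prec G$ means that $F(z)=G(w(z))$ on $\mathbb U$ for some $w$ analytic in $\mathbb U$ with $w(0)=0$ and $|w(z)|<1$. Let $U_n$ be the Chebyshev polynomials of the second kind, so that $U_1(t)=2t$, $U_2(t)=4t^2-1$, $U_3(t)=8t^3-4t$, and let $G(t,z)=\dfrac1{1-2tz+z^2}$ be their generating function. Let $\lambda\ge1$, $\mu\ge0$, $\delta\ge1$, $t\in(1/2,1]$, and put $$f_\delta(z)=\int_0^z\Big(\frac{1+r}{1-r}\Big)^{\delta}\frac{dr}{1-r^2}=z+\sum_{n\ge2}b_n(\delta)z^n .$$ For $f(z)=z+\sum_{n\ge2}a_nz^n$ in $\mathcal A$ put $h_\delta(z)=(f*f_\delta)(z)=z+\sum_{n\ge2}a_nb_n(\delta)z^n$.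 Suppose that $h_\delta\in\mathcal N_\sigma^{\mu,\delta}(\lambda,t)$, that is, $h_\delta\in\sigma$ and, with $k_\delta=h_\delta^{-1}$, $$(1-\lambda)\Big(\frac{h_\delta(z)}z\Big)^{\mu}+\lambda h_\delta'(z)\Big(\frac{h_\delta(z)}z\Big)^{\mu-1}\prec G(t,z),\qquad (1-\lambda)\Big(\frac{k_\delta(w)}w\Big)^{\mu}+\lambda k_\delta'(w)\Big(\frac{k_\delta(w)}w\Big)^{\mu-1}\prec G(t,w)$$ in $\mathbb U$, where the powers are the analytic branches with value $1$ at the origin. Write $U_n=U_n(t)$ and $$\Omega=18(2\delta^2+1)^2(\lambda+\mu)^3U_3-U_1^3(3\lambda+\mu)\big(3(2\delta^2+1)^2(\mu^2+3\mu-4)+54\delta(\delta^3+2\delta)\big),$$ $$\begin{aligned}\chi_1={}&(2\lambda+\mu)^2U_1|\Omega|+18(\lambda+\mu)^3\big(3\delta(\delta^3+2\delta)(\lambda+\mu)(3\lambda+\mu)-(2\delta^2+1)^2(2\lambda+\mu)^2\big)U_1^2\\&-9(\lambda+\mu)^2(2\lambda+\mu)U_1\big((3\lambda+\mu)(8\delta^4-4\delta^2+5)U_1^2+4(2\delta^2+1)^2(2\lambda+\mu)(\lambda+\mu)U_2\big),\end{aligned}$$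 $$\begin{aligned}\chi_2={}&(\lambda+\mu)^2\Big[(2\lambda+\mu)(3\lambda+\mu)(8\delta^4-4\delta^2+5)U_1^3+4(2\delta^2+1)^2(\lambda+\mu)(2\lambda+\mu)^2U_1U_2\\&+(\lambda+\mu)U_1^2\big(2(2\delta^2+1)^2(2\lambda+\mu)^2-12\delta(\delta^3+2\delta)(\lambda+\mu)(3\lambda+\mu)\big)\Big],\end{aligned}$$ $$\varphi(2^-,t)=\frac{9U_1^2}{(2\delta^2+1)^2(2\lambda+\mu)^2}+\frac{\chi_1+9\chi_2}{6\delta(\delta^3+2\delta)(2\delta^2+1)^2(3\lambda+\mu)(2\lambda+\mu)^2(\lambda+\mu)^4},$$ and, when $\chi_1<0<\chi_2$, with $c_0=\sqrt{-18\chi_2/\chi_1}$, $$\varphi(c_0,t)=\frac{9U_1^2}{(2\delta^2+1)^2(2\lambda+\mu)^2}-\frac{27\chi_2^2}{8\chi_1\delta(\delta^3+2\delta)(2\delta^2+1)^2(3\lambda+\mu)(2\lambda+\mu)^2(\lambda+\mu)^4}.$$ Then the coefficients $a_n$ of $f$ satisfy $$|a_2a_4-a_3^2|\le\begin{cases}\varphi(2^-,t),&\chi_1\ge0\text{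 and }\chi_2\ge0,\\[2pt]\dfrac{36t^2}{(2\delta^2+1)^2(2\lambda+\mu)^2},&\chi_1\le0\text{ and }\chi_2\le0,\\[6pt]\max\Big\{\dfrac{36t^2}{(2\delta^2+1)^2(2\lambda+\mu)^2},\ \varphi(2^-,t)\Big\},&\chi_1>0\text{ and }\chi_2<0,\\[6pt]\max\{\varphi(c_0,t),\ \varphi(2^-,t)\},&\chi_1<0\text{ and }\chi_2>0.\end{cases}$$ -/

import Mathlib

open Set Filter Topology

noncomputable section

namespace BiUnivalent

/-- The open unit disk `𝕌` of the complex plane. -/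
def unitDisk : Set ℂ := Metric.ball (0 : ℂ) 1

/-- The `n`-th Taylor coefficient of `f` at the origin. -/
def taylorCoeff (f : ℂ → ℂ) (n : ℕ) : ℂ := iteratedDeriv n f 0 / (n.factorial : ℂ)

/-- The class `𝒜`: functions analytic in the unit disk with `f(z) = z + ∑_{n ≥ 2} aₙ zⁿ`. -/
def classA : Set (ℂ → ℂ) :=
  {f | DifferentiableOn ℂ f unitDisk ∧ f 0 = 0 ∧ deriv f 0 = 1}

/-- `F ≺ G` in the unit disk: `F = G ∘ w` there, for a Schwarz function `w`. -/
def Subordinate (F G : ℂ → ℂ) : Prop :=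
  ∃ w : ℂ → ℂ, DifferentiableOn ℂ w unitDisk ∧ w 0 = 0 ∧ (∀ z ∈ unitDisk, ‖w z‖ < 1) ∧
    ∀ z ∈ unitDisk, F z = G (w z)

/-- The Hadamard product (convolution) `(f * g)(z) = ∑ aₙ bₙ zⁿ` of
`f(z) = ∑ aₙ zⁿ` and `g(z) = ∑ bₙ zⁿ`. -/
def hadamard (f g : ℂ → ℂ) (z : ℂ) : ℂ :=
  ∑' n : ℕ, taylorCoeff f n * taylorCoeff g n * z ^ n

/-- `f_δ(z) = ∫₀ᶻ ((1 + r) / (1 - r))^δ / (1 - r²) dr`, integrated along the segment `r = s z`,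
`0 ≤ s ≤ 1`. For `|r| < 1` the quotient `(1 + r) / (1 - r)` has positive real part, so that the
power is the principal one. -/
def fDelta (δ : ℝ) (z : ℂ) : ℂ :=
  ∫ s in (0 : ℝ)..1,
    ((1 + (s : ℂ) * z) / (1 - (s : ℂ) * z)) ^ (δ : ℂ) / (1 - ((s : ℂ) * z) ^ 2) * z

/-- `k` is the analytic continuation to the unit disk of the local inverse of `h` at the origin,
and it is univalent there. -/
def IsUnivalentInverse (h k : ℂ → ℂ) : Prop :=
  DifferentiableOn ℂ k unitDisk ∧ InjOn k unitDisk ∧ ∀ᶠ z in 𝓝 (0 : ℂ), k (h z) = z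

/-- The class `σ` of bi-univalent functions: `h ∈ 𝒜` is univalent in the unit disk, and so is
its inverse. -/
def classSigma : Set (ℂ → ℂ) :=
  {h | h ∈ classA ∧ InjOn h unitDisk ∧ ∃ k, IsUnivalentInverse h k}

/-- `L` is the analytic branch of `log (h(z) / z)` in the unit disk with `L(0) = 0`; then
`(h(z) / z)^μ = exp (μ L(z))` is the analytic branch of the power with value `1` at the origin. -/
def IsLogBranch (h L : ℂ → ℂ) : Prop :=
  DifferentiableOn ℂ L unitDisk ∧ L 0 = 0 ∧ ∀ z ∈ unitDisk, h z = z * Complex.exp (L z)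

/-- `(1 - l) (h(z) / z)^μ + l h'(z) (h(z) / z)^(μ - 1)`, where `L` is the branch of
`log (h(z) / z)`. -/
def bazilevic (l μ : ℝ) (h L : ℂ → ℂ) (z : ℂ) : ℂ :=
  (1 - (l : ℂ)) * Complex.exp ((μ : ℂ) * L z) +
    (l : ℂ) * deriv h z * Complex.exp (((μ : ℂ) - 1) * L z)

/-- The generating function `G(t, z) = 1 / (1 - 2 t z + z²)` of the Chebyshev polynomials of the
second kind. -/
def chebyshevG (t : ℝ) (z : ℂ) : ℂ := 1 / (1 - 2 * (t : ℂ) * z + z ^ 2)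

/-- `(1 - l) (h(z) / z)^μ + l h'(z) (h(z) / z)^(μ - 1) ≺ G(t, z)` in the unit disk. -/
def SubordinateToG (l μ t : ℝ) (h : ℂ → ℂ) : Prop :=
  ∃ L, IsLogBranch h L ∧ Subordinate (bazilevic l μ h L) (chebyshevG t)

/-- The class `𝒩_σ^{μ,δ}(l, t)`: the bi-univalent functions of the form `h = f * f_δ` with
`f ∈ 𝒜` such that `h` and its inverse `k` both satisfy the subordination. -/
def classN (μ δ l t : ℝ) : Set (ℂ → ℂ) :=
  {h | h ∈ classSigma ∧ (∃ f ∈ classA, EqOn h (hadamard f (fDelta δ)) unitDisk) ∧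
    SubordinateToG l μ t h ∧ ∃ k, IsUnivalentInverse h k ∧ SubordinateToG l μ t k}

/-- The value `U_n(t)` of the Chebyshev polynomial of the second kind. -/
def chebU (n : ℤ) (t : ℝ) : ℝ := (Polynomial.Chebyshev.U ℝ n).eval t

/-- `Ω_{l,μ,δ}(t)`. -/
def Omega (l μ δ t : ℝ) : ℝ :=
  18 * (2 * δ ^ 2 + 1) ^ 2 * (l + μ) ^ 3 * chebU 3 t
    - chebU 1 t ^ 3 * (3 * l + μ) *
      (3 * (2 * δ ^ 2 + 1) ^ 2 * (μ ^ 2 + 3 * μ - 4) + 54 * δ * (δ ^ 3 + 2 * δ))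

/-- `χ₁`. -/
def chi1 (l μ δ t : ℝ) : ℝ :=
  (2 * l + μ) ^ 2 * chebU 1 t * |Omega l μ δ t|
    + 18 * (l + μ) ^ 3 *
      (3 * δ * (δ ^ 3 + 2 * δ) * (l + μ) * (3 * l + μ)
        - (2 * δ ^ 2 + 1) ^ 2 * (2 * l + μ) ^ 2) * chebU 1 t ^ 2
    - 9 * (l + μ) ^ 2 * (2 * l + μ) * chebU 1 t *
      ((3 * l + μ) * (8 * δ ^ 4 - 4 * δ ^ 2 + 5) * chebU 1 t ^ 2
        + 4 * (2 * δ ^ 2 + 1) ^ 2 * (2 * l + μ) * (l + μ) * chebU 2 t)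

/-- `χ₂`. -/
def chi2 (l μ δ t : ℝ) : ℝ :=
  ((2 * l + μ) * (3 * l + μ) * (8 * δ ^ 4 - 4 * δ ^ 2 + 5) * chebU 1 t ^ 3
    + 4 * (2 * δ ^ 2 + 1) ^ 2 * (l + μ) * (2 * l + μ) ^ 2 * chebU 1 t * chebU 2 t
    + (l + μ) * chebU 1 t ^ 2 *
      (2 * (2 * δ ^ 2 + 1) ^ 2 * (2 * l + μ) ^ 2
        - 12 * δ * (δ ^ 3 + 2 * δ) * (l + μ) * (3 * l + μ))) * (l + μ) ^ 2

/-- `φ(2⁻, t)`. -/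
def phiTwo (l μ δ t : ℝ) : ℝ :=
  9 * chebU 1 t ^ 2 / ((2 * δ ^ 2 + 1) ^ 2 * (2 * l + μ) ^ 2)
    + (chi1 l μ δ t + 9 * chi2 l μ δ t) /
      (6 * δ * (δ ^ 3 + 2 * δ) * (2 * δ ^ 2 + 1) ^ 2 * (3 * l + μ) * (2 * l + μ) ^ 2
        * (l + μ) ^ 4)

/-- `φ(c₀, t)`, where `c₀ = √(-18 χ₂ / χ₁)`; it is used only for `χ₁ < 0`. -/
def phiCrit (l μ δ t : ℝ) : ℝ :=
  9 * chebU 1 t ^ 2 / ((2 * δ ^ 2 + 1) ^ 2 * (2 * l + μ) ^ 2)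
    - 27 * chi2 l μ δ t ^ 2 /
      (8 * chi1 l μ δ t * δ * (δ ^ 3 + 2 * δ) * (2 * δ ^ 2 + 1) ^ 2 * (3 * l + μ)
        * (2 * l + μ) ^ 2 * (l + μ) ^ 4)

end BiUnivalent

end

/-!
Write `h(z) = z exp L(z)` and `k(w) = w exp M(w)` for the inverse `k` of `h`. The Bazilevič
expression of `h` is then `exp (μ L) (1 + l z L')` (`bazilevic_eq`), and the subordination expresses
the first three coefficients of `L` through the coefficients `p₁, p₂, p₃` of a Schwarz function and
the Chebyshev values `U₁, U₂, U₃`; likewise for `M` and a second Schwarz function with coefficients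
`q₁, q₂, q₃` (`coeff_of_subordinate`). Since `L + M ∘ h = 0` near the origin, the coefficients of `M`
are polynomials in those of `L` (`inverse_log_coeff`). In particular `q₁ = -p₁`, and elimination
gives
`a₂ a₄ - a₃² = T p₁⁴ + K₁ p₁² (p₂ - q₂) + K₂ p₁² (p₂ + q₂) + K₃ p₁ (p₃ - q₃) - K₄ (p₂ - q₂)²`
with real constants, where `T` is a positive multiple of `Ω` (`hankel_eq`). The coefficients of the
Hadamard factor `f_δ` come from its derivative `((1 + z) / (1 - z))^δ / (1 - z²)`
(`taylorCoeff_fDelta`).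

The Schur algorithm bounds `p₂, p₃` by `|p₁|` and the modulus of a second parameter
(`schwarz_coeff_bounds`). After the triangle inequality the bound is largest when the second
parameters have modulus `1`, because `K₃ ≤ 4 K₄` (`bound_le_of_schur_params`). What remains is the
quadratic polynomial `χ₁ s² + 9 χ₂ s` in `s = |p₁|² ∈ [0, 1]`, up to a positive factor and an
additive constant (`bound_eq_quadratic`, `hankel_bound`), whose maximum depends on the signs of `χ₁`
and `χ₂`: it is at `s = 1`, at `s = 0`, at one of these two, or at most the value at the vertex.

Coefficient comparisons are made with `3`-jets at the origin (`HasJet`), which are unique and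
compatible with sums, products and compositions.
-/

namespace BiUnivalent

open Asymptotics

open scoped ComplexConjugate

/-! ### Jets at the origin -/

/-- `f(z) = a₀ + a₁ z + a₂ z² + a₃ z³ + O(z⁴)` as `z → 0`: the `3`-jet of `f` at the origin. -/
def HasJet (f : ℂ → ℂ) (a₀ a₁ a₂ a₃ : ℂ) : Prop :=
  (fun z => f z - (a₀ + a₁ * z + a₂ * z ^ 2 + a₃ * z ^ 3)) =O[𝓝 0] fun z : ℂ => z ^ 4

theorem isBigO_pow_pow_of_le {m n : ℕ} (h : m ≤ n) :
    (fun z : ℂ => z ^ n) =O[𝓝 0] fun z : ℂ => z ^ m := by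
  rcases h.eq_or_lt with rfl | h
  · exact isBigO_refl _ _
  · exact (isLittleO_pow_pow h).isBigO

/-- A function continuous at the origin times `zⁿ` is `O(zⁿ)`. -/
theorem isBigO_pow_mul {g : ℂ → ℂ} (hg : ContinuousAt g 0) (n : ℕ) :
    (fun z : ℂ => z ^ n * g z) =O[𝓝 0] fun z : ℂ => z ^ n := by
  simpa using (isBigO_refl (fun z : ℂ => z ^ n) (𝓝 0)).mul (hg.isBigO_one ℂ)

theorem eq_zero_of_isBigO_pow {c : ℂ} {k : ℕ}
    (h : (fun z : ℂ => c * z ^ k) =O[𝓝 0] fun z : ℂ => z ^ (k + 1)) : c = 0 := by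
  by_contra hc
  have h1 : (fun z : ℂ => z ^ k) =o[𝓝 0] fun z : ℂ => z ^ k :=
    ((isBigO_const_mul_left_iff hc).mp h).trans_isLittleO (isLittleO_pow_pow k.lt_succ_self)
  have h2 := (isLittleO_irrefl' (l := 𝓝[≠] (0 : ℂ)) (f' := fun z : ℂ => z ^ k) ?_)
  · exact h2 (h1.mono nhdsWithin_le_nhds)
  · refine Eventually.frequently ?_
    filter_upwards [self_mem_nhdsWithin] with z hz
    exact norm_ne_zero_iff.mpr (pow_ne_zero k hz)

/-- A polynomial `∑_{k < n} cₖ zᵏ` that is `O(zⁿ)` at the origin vanishes identically. -/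
theorem coeff_eq_zero_of_isBigO (c : ℕ → ℂ) (n : ℕ)
    (h : (fun z : ℂ => ∑ k ∈ Finset.range n, c k * z ^ k) =O[𝓝 0] fun z : ℂ => z ^ n) :
    ∀ k < n, c k = 0 := by
  intro k
  induction k using Nat.strong_induction_on with
  | _ k ih =>
    intro hk
    apply eq_zero_of_isBigO_pow (k := k)
    have h1 : (fun z : ℂ => ∑ i ∈ (Finset.range n).erase k, c i * z ^ i)
        =O[𝓝 0] fun z : ℂ => z ^ (k + 1) := by
      refine IsBigO.fun_sum fun i hi => ?_
      rcases lt_or_gt_of_ne (Finset.ne_of_mem_erase hi) with hlt | hgt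
      · simp only [ih i hlt (hlt.trans hk), zero_mul]
        exact isBigO_zero _ _
      · exact (isBigO_pow_pow_of_le hgt).const_mul_left _
    refine ((h.trans (isBigO_pow_pow_of_le hk)).sub h1).congr_left fun z => ?_
    rw [← Finset.add_sum_erase _ _ (Finset.mem_range.mpr hk)]
    ring

/-- Taylor's formula in terms of `taylorCoeff`. -/
theorem isBigO_sub_taylor {f : ℂ → ℂ} (hf : AnalyticAt ℂ f 0) (n : ℕ) :
    (fun z => f z - ∑ k ∈ Finset.range n, taylorCoeff f k * z ^ k) =O[𝓝 0]
      fun z : ℂ => z ^ n := by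
  have h := hf.hasFPowerSeriesAt.isBigO_sub_partialSum_pow n
  simp only [zero_add, ← norm_pow] at h
  refine h.of_norm_right.congr_left fun z => ?_
  simp [FormalMultilinearSeries.partialSum, taylorCoeff, mul_comm]

namespace HasJet

variable {f g : ℂ → ℂ} {a₀ a₁ a₂ a₃ b₀ b₁ b₂ b₃ : ℂ}

theorem of_analyticAt (hf : AnalyticAt ℂ f 0) :
    HasJet f (taylorCoeff f 0) (taylorCoeff f 1) (taylorCoeff f 2) (taylorCoeff f 3) := by
  simpa [HasJet, Finset.sum_range_succ] using isBigO_sub_taylor hf 4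

theorem unique (hf : HasJet f a₀ a₁ a₂ a₃) (hg : HasJet f b₀ b₁ b₂ b₃) :
    a₀ = b₀ ∧ a₁ = b₁ ∧ a₂ = b₂ ∧ a₃ = b₃ := by
  have h := coeff_eq_zero_of_isBigO
    (fun k => ![a₀ - b₀, a₁ - b₁, a₂ - b₂, a₃ - b₃] (Fin.ofNat 4 k)) 4
    ((IsBigO.sub hg hf).congr_left fun z => by
      simp [Finset.sum_range_succ, Fin.ofNat]; ring)
  have h0 := h 0 (by norm_num)
  have h1 := h 1 (by norm_num)
  have h2 := h 2 (by norm_num)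
  have h3 := h 3 (by norm_num)
  simp only [Fin.ofNat] at h0 h1 h2 h3
  exact ⟨sub_eq_zero.mp h0, sub_eq_zero.mp h1, sub_eq_zero.mp h2, sub_eq_zero.mp h3⟩

theorem congr (hf : HasJet f a₀ a₁ a₂ a₃) (h : f =ᶠ[𝓝 0] g) : HasJet g a₀ a₁ a₂ a₃ :=
  IsBigO.congr' hf (h.mono fun z hz => by simp only [hz]) EventuallyEq.rfl

theorem of_cubic (a₀ a₁ a₂ a₃ : ℂ) (h : ∀ z, f z = a₀ + a₁ * z + a₂ * z ^ 2 + a₃ * z ^ 3) :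
    HasJet f a₀ a₁ a₂ a₃ := by
  simp only [HasJet, h, sub_self]
  exact isBigO_zero _ _

theorem const (c : ℂ) : HasJet (fun _ => c) c 0 0 0 := of_cubic _ _ _ _ fun z => by ring

theorem add (hf : HasJet f a₀ a₁ a₂ a₃) (hg : HasJet g b₀ b₁ b₂ b₃) :
    HasJet (fun z => f z + g z) (a₀ + b₀) (a₁ + b₁) (a₂ + b₂) (a₃ + b₃) :=
  (IsBigO.add hf hg).congr_left fun z => by ring

theorem tendsto (hf : HasJet f a₀ a₁ a₂ a₃) : Tendsto f (𝓝 0) (𝓝 a₀) := by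
  have h1 : Tendsto (fun z => f z - (a₀ + a₁ * z + a₂ * z ^ 2 + a₃ * z ^ 3)) (𝓝 0) (𝓝 0) := by
    refine IsBigO.trans_tendsto hf ?_
    have : ContinuousAt (fun z : ℂ => z ^ 4) 0 := by fun_prop
    simpa [ContinuousAt] using this
  have h2 : Tendsto (fun z : ℂ => a₀ + a₁ * z + a₂ * z ^ 2 + a₃ * z ^ 3) (𝓝 0) (𝓝 a₀) := by
    have : ContinuousAt (fun z : ℂ => a₀ + a₁ * z + a₂ * z ^ 2 + a₃ * z ^ 3) 0 := by fun_prop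
    simpa [ContinuousAt] using this
  simpa using h1.add h2

theorem isBigO_one (hf : HasJet f a₀ a₁ a₂ a₃) : f =O[𝓝 0] fun _ => (1 : ℂ) :=
  hf.tendsto.isBigO_one ℂ

theorem mul (hf : HasJet f a₀ a₁ a₂ a₃) (hg : HasJet g b₀ b₁ b₂ b₃) :
    HasJet (fun z => f z * g z) (a₀ * b₀) (a₀ * b₁ + a₁ * b₀) (a₀ * b₂ + a₁ * b₁ + a₂ * b₀)
      (a₀ * b₃ + a₁ * b₂ + a₂ * b₁ + a₃ * b₀) := by
  have h1 : (fun z => (f z - (a₀ + a₁ * z + a₂ * z ^ 2 + a₃ * z ^ 3)) * g z)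
      =O[𝓝 0] fun z : ℂ => z ^ 4 := by
    simpa using IsBigO.mul hf hg.isBigO_one
  have h2 : (fun z => (a₀ + a₁ * z + a₂ * z ^ 2 + a₃ * z ^ 3) *
      (g z - (b₀ + b₁ * z + b₂ * z ^ 2 + b₃ * z ^ 3))) =O[𝓝 0] fun z : ℂ => z ^ 4 := by
    simpa using IsBigO.mul
      (of_cubic (f := fun z => a₀ + a₁ * z + a₂ * z ^ 2 + a₃ * z ^ 3)
        _ _ _ _ fun _ => rfl).isBigO_one
      hg
  have h3 := isBigO_pow_mul (g := fun z : ℂ => (a₁ * b₃ + a₂ * b₂ + a₃ * b₁) +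
      (a₂ * b₃ + a₃ * b₂) * z + a₃ * b₃ * z ^ 2) (by fun_prop) 4
  exact ((h1.add h2).add h3).congr_left fun z => by ring

theorem const_mul (hf : HasJet f a₀ a₁ a₂ a₃) (c : ℂ) :
    HasJet (fun z => c * f z) (c * a₀) (c * a₁) (c * a₂) (c * a₃) := by
  simpa using (const c).mul hf

theorem id_mul (hf : HasJet f a₀ a₁ a₂ a₃) : HasJet (fun z => z * f z) 0 a₀ a₁ a₂ := by
  simpa using (of_cubic (f := fun z => z) 0 1 0 0 fun z => by ring).mul hf

theorem comp (hf : HasJet f a₀ a₁ a₂ a₃) (hg : HasJet g 0 b₁ b₂ b₃) :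
    HasJet (fun z => f (g z)) a₀ (a₁ * b₁) (a₁ * b₂ + a₂ * b₁ ^ 2)
      (a₁ * b₃ + 2 * a₂ * b₁ * b₂ + a₃ * b₁ ^ 3) := by
  have hg2 := hg.mul hg
  have hg3 := hg2.mul hg
  have hg1 : g =O[𝓝 0] fun z : ℂ => z := by
    have h1 : (fun z => g z - (0 + b₁ * z + b₂ * z ^ 2 + b₃ * z ^ 3)) =O[𝓝 0] fun z : ℂ => z := by
      simpa using IsBigO.trans hg (isBigO_pow_pow_of_le (show 1 ≤ 4 by norm_num))
    have h2 : (fun z : ℂ => z ^ 1 * (b₁ + b₂ * z + b₃ * z ^ 2)) =O[𝓝 0] fun z : ℂ => z := by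
      simpa using isBigO_pow_mul (g := fun z : ℂ => b₁ + b₂ * z + b₃ * z ^ 2) (by fun_prop) 1
    exact (h1.add h2).congr_left fun z => by ring
  have h0 : (fun z => f (g z) - (a₀ + a₁ * g z + a₂ * g z ^ 2 + a₃ * g z ^ 3))
      =O[𝓝 0] fun z : ℂ => z ^ 4 :=
    (IsBigO.comp_tendsto hf hg.tendsto).trans (hg1.pow 4)
  have h1 := (((const a₀).add (hg.const_mul a₁)).add (hg2.const_mul a₂)).add (hg3.const_mul a₃)
  refine (h0.add h1).congr_left fun z => ?_
  ring

theorem exp : HasJet Complex.exp 1 1 (1 / 2) (1 / 6) := by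
  have h := of_analyticAt (f := Complex.exp) analyticAt_cexp
  have he : ∀ n, iteratedDeriv n Complex.exp 0 = 1 := fun n => by
    simp [iteratedDeriv_eq_iterate]
  simpa [taylorCoeff, he, Nat.factorial] using h

theorem cexp (hf : HasJet f 0 a₁ a₂ a₃) :
    HasJet (fun z => Complex.exp (f z)) 1 a₁ (a₂ + a₁ ^ 2 / 2)
      (a₃ + a₁ * a₂ + a₁ ^ 3 / 6) := by
  convert exp.comp hf using 1 <;> ring

end HasJet

theorem taylorCoeff_zero (f : ℂ → ℂ) : taylorCoeff f 0 = f 0 := by simp [taylorCoeff]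

theorem taylorCoeff_deriv (f : ℂ → ℂ) (n : ℕ) :
    taylorCoeff (deriv f) n = (n + 1) * taylorCoeff f (n + 1) := by
  have h1 : ((n : ℂ) + 1) ≠ 0 := by exact_mod_cast n.succ_ne_zero
  have h2 : (n.factorial : ℂ) ≠ 0 := by exact_mod_cast n.factorial_ne_zero
  rw [taylorCoeff, taylorCoeff, ← iteratedDeriv_succ', Nat.factorial_succ]
  push_cast
  field_simp

/-- Multiplication by `z` shifts the Taylor coefficients. -/
theorem taylorCoeff_of_eq_id_mul {f g : ℂ → ℂ} (hf : AnalyticAt ℂ f 0) (hg : AnalyticAt ℂ g 0)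
    (h : ∀ᶠ z in 𝓝 0, f z = z * g z) (n : ℕ) : taylorCoeff f (n + 1) = taylorCoeff g n := by
  have h1 := isBigO_sub_taylor hf (n + 2)
  have h2 : (fun z => f z - z * ∑ k ∈ Finset.range (n + 1), taylorCoeff g k * z ^ k)
      =O[𝓝 0] fun z : ℂ => z ^ (n + 2) := by
    refine ((isBigO_refl (fun z : ℂ => z) (𝓝 0)).mul (isBigO_sub_taylor hg (n + 1))).congr' ?_ ?_
    · filter_upwards [h] with z hz
      rw [hz]; ring
    · exact Eventually.of_forall fun z => by ring
  have h3 := coeff_eq_zero_of_isBigO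
    (fun k => taylorCoeff f k - if k = 0 then 0 else taylorCoeff g (k - 1)) (n + 2)
    ((h2.sub h1).congr_left fun z => by
      simp only [sub_mul, Finset.sum_sub_distrib, Finset.mul_sum]
      rw [Finset.sum_range_succ' (fun k => (if k = 0 then 0 else taylorCoeff g (k - 1)) * z ^ k)]
      simp only [Nat.add_eq_zero_iff, one_ne_zero, and_false, if_false, Nat.add_sub_cancel, if_true,
        zero_mul, add_zero]
      have : ∀ k, z * (taylorCoeff g k * z ^ k) = taylorCoeff g k * z ^ (k + 1) := fun k => by ring
      simp only [this]
      ring)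
    (n + 1) (by omega)
  simpa [sub_eq_zero] using h3

/-! ### The unit disk -/

theorem unitDisk_mem_nhds : unitDisk ∈ 𝓝 (0 : ℂ) := Metric.ball_mem_nhds _ one_pos

theorem zero_mem_unitDisk : (0 : ℂ) ∈ unitDisk := Metric.mem_ball_self one_pos

theorem mem_unitDisk {z : ℂ} : z ∈ unitDisk ↔ ‖z‖ < 1 := mem_ball_zero_iff

theorem analyticAt_of_differentiableOn {f : ℂ → ℂ} (hf : DifferentiableOn ℂ f unitDisk) :
    AnalyticAt ℂ f 0 :=
  hf.analyticAt unitDisk_mem_nhds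

/-! ### Hadamard products and the function `f_δ` -/

theorem exists_taylorCoeff_bound {f : ℂ → ℂ} (hf : AnalyticAt ℂ f 0) :
    ∃ C r : ℝ, 0 < r ∧ ∀ n, ‖taylorCoeff f n‖ * r ^ n ≤ C := by
  obtain ⟨r, hr0, hr⟩ := ENNReal.lt_iff_exists_nnreal_btwn.mp hf.hasFPowerSeriesAt.radius_pos
  obtain ⟨C, -, hC⟩ := FormalMultilinearSeries.norm_mul_pow_le_of_lt_radius _ hr
  refine ⟨C, r, by exact_mod_cast hr0, fun n => ?_⟩
  simpa [taylorCoeff] using hC n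

/-- The Hadamard product multiplies the Taylor coefficients: the product of two series of positive
radius of convergence again has a positive radius of convergence. -/
theorem taylorCoeff_hadamard {f g : ℂ → ℂ} (hf : AnalyticAt ℂ f 0) (hg : AnalyticAt ℂ g 0)
    (n : ℕ) : taylorCoeff (hadamard f g) n = taylorCoeff f n * taylorCoeff g n := by
  obtain ⟨C, r, hr, hC⟩ := exists_taylorCoeff_bound hf
  obtain ⟨C', r', hr', hC'⟩ := exists_taylorCoeff_bound hg
  have hC0 : 0 ≤ C := le_trans (by positivity) (hC 0)
  set c : ℕ → ℂ := fun n => taylorCoeff f n * taylorCoeff g n with hc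
  set p := FormalMultilinearSeries.ofScalars ℂ c with hp
  have hrad : 0 < p.radius := by
    lift r to NNReal using hr.le
    lift r' to NNReal using hr'.le
    have h1 : ((r * r' : NNReal) : ENNReal) ≤ p.radius := by
      refine p.le_radius_of_bound (C * C') fun n => ?_
      have := mul_le_mul (hC n) (hC' n) (by positivity) hC0
      simp only [hp, hc, FormalMultilinearSeries.ofScalars_norm, norm_mul, NNReal.coe_mul, mul_pow]
      linarith
    refine lt_of_lt_of_le ?_ h1
    exact_mod_cast mul_pos hr hr'
  have hsum : p.sum = hadamard f g := by
    funext z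
    simp [hadamard, FormalMultilinearSeries.sum, hp, hc, mul_comm]
  have hps : HasFPowerSeriesAt (hadamard f g) p 0 :=
    hsum ▸ (p.hasFPowerSeriesOnBall hrad).hasFPowerSeriesAt
  have heq := hps.eq_formalMultilinearSeries hps.analyticAt.hasFPowerSeriesAt
  exact (congrFun (FormalMultilinearSeries.ofScalars_series_injective ℂ ℂ heq) n).symm

theorem one_sub_ne_zero_of_mem {z : ℂ} (hz : z ∈ unitDisk) : 1 - z ≠ 0 := by
  intro h
  rw [mem_unitDisk, ← sub_eq_zero.mp h] at hz
  simp at hz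

/-- The Möbius transformation `(1 + z) / (1 - z)` maps the unit disk to the right half plane. -/
theorem cayley_mem_slitPlane {z : ℂ} (hz : z ∈ unitDisk) :
    (1 + z) / (1 - z) ∈ Complex.slitPlane := by
  have h1 := one_sub_ne_zero_of_mem hz
  rw [mem_unitDisk] at hz
  left
  have h2 : 0 < Complex.normSq (1 - z) := Complex.normSq_pos.mpr h1
  have h3 : Complex.normSq z < 1 := by
    rw [Complex.normSq_eq_norm_sq]
    nlinarith [norm_nonneg z]
  rw [Complex.div_re, ← add_div]
  apply div_pos _ h2
  simp [Complex.normSq_apply] at h3 ⊢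
  nlinarith

theorem one_add_ne_zero_of_mem {z : ℂ} (hz : z ∈ unitDisk) : 1 + z ≠ 0 := by
  have := one_sub_ne_zero_of_mem (z := -z) (by simpa [mem_unitDisk] using hz)
  simpa using this

theorem one_sub_sq_ne_zero_of_mem {z : ℂ} (hz : z ∈ unitDisk) : 1 - z ^ 2 ≠ 0 := by
  have := mul_ne_zero (one_sub_ne_zero_of_mem hz) (one_add_ne_zero_of_mem hz)
  intro h
  apply this
  linear_combination h

/-- The derivative `((1 + z) / (1 - z))^δ / (1 - z²)` of `f_δ`, with the principal power. -/
noncomputable def fDeltaDeriv (δ : ℝ) (z : ℂ) : ℂ := ((1 + z) / (1 - z)) ^ (δ : ℂ) / (1 - z ^ 2)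

theorem hasDerivAt_cayley_cpow {δ : ℝ} (hδ : δ ≠ 0) {z : ℂ} (hz : z ∈ unitDisk) :
    HasDerivAt (fun z : ℂ => ((1 + z) / (1 - z)) ^ (δ : ℂ) / (2 * δ)) (fDeltaDeriv δ z) z := by
  have h1 := one_sub_ne_zero_of_mem hz
  have h2 := one_add_ne_zero_of_mem hz
  have h3 := one_sub_sq_ne_zero_of_mem hz
  have hδ' : (δ : ℂ) ≠ 0 := by exact_mod_cast hδ
  have hq : HasDerivAt (fun z : ℂ => (1 + z) / (1 - z)) (2 / (1 - z) ^ 2) z := by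
    refine (((hasDerivAt_id z).const_add 1).div ((hasDerivAt_id z).const_sub 1) h1).congr_deriv ?_
    simp only [id]
    ring
  have h4 := (hq.cpow_const (c := (δ : ℂ)) (cayley_mem_slitPlane hz)).div_const (2 * δ)
  refine h4.congr_deriv ?_
  rw [Complex.cpow_sub _ _ (div_ne_zero h2 h1), Complex.cpow_one, fDeltaDeriv]
  have : 1 - z ^ 2 = (1 - z) * (1 + z) := by ring
  rw [this]
  field_simp

theorem differentiableOn_fDeltaDeriv (δ : ℝ) : DifferentiableOn ℂ (fDeltaDeriv δ) unitDisk := by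
  intro z hz
  have h1 := one_sub_ne_zero_of_mem hz
  have h3 := one_sub_sq_ne_zero_of_mem hz
  apply DifferentiableAt.differentiableWithinAt
  unfold fDeltaDeriv
  have hq : DifferentiableAt ℂ (fun z : ℂ => (1 + z) / (1 - z)) z := by
    fun_prop (disch := assumption)
  exact (hq.cpow_const (cayley_mem_slitPlane hz)).div (by fun_prop) h3

/-- The integral defining `f_δ` in closed form. -/
theorem fDelta_eq {δ : ℝ} (hδ : δ ≠ 0) {z : ℂ} (hz : z ∈ unitDisk) :
    fDelta δ z = ((1 + z) / (1 - z)) ^ (δ : ℂ) / (2 * δ) - 1 / (2 * δ) := by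
  have hmem : ∀ s ∈ uIcc (0 : ℝ) 1, (s : ℂ) * z ∈ unitDisk := by
    intro s hs
    rw [uIcc_of_le zero_le_one] at hs
    rw [mem_unitDisk] at hz ⊢
    rw [norm_mul, Complex.norm_real, Real.norm_of_nonneg hs.1]
    exact lt_of_le_of_lt (mul_le_of_le_one_left (norm_nonneg _) hs.2) hz
  have hd : ∀ s ∈ uIcc (0 : ℝ) 1, HasDerivAt
      (fun s : ℝ => ((1 + (s : ℂ) * z) / (1 - (s : ℂ) * z)) ^ (δ : ℂ) / (2 * δ))
      (fDeltaDeriv δ (s * z) * z) s := by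
    intro s hs
    have h2 : HasDerivAt (fun s : ℝ => (s : ℂ) * z) z s := by
      simpa using (Complex.ofRealCLM.hasDerivAt (x := s)).mul_const z
    exact (hasDerivAt_cayley_cpow hδ (hmem s hs)).comp s h2
  have hc : ContinuousOn (fun s : ℝ => fDeltaDeriv δ (s * z) * z) (uIcc 0 1) :=
    ((differentiableOn_fDeltaDeriv δ).continuousOn.comp (by fun_prop) hmem).mul continuousOn_const
  have := intervalIntegral.integral_eq_sub_of_hasDerivAt hd hc.intervalIntegrable
  simpa [fDelta, fDeltaDeriv] using this

theorem hasDerivAt_fDelta {δ : ℝ} (hδ : δ ≠ 0) {z : ℂ} (hz : z ∈ unitDisk) :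
    HasDerivAt (fDelta δ) (fDeltaDeriv δ z) z := by
  refine ((hasDerivAt_cayley_cpow hδ hz).sub_const (1 / (2 * (δ : ℂ)))).congr_of_eventuallyEq ?_
  filter_upwards [Metric.isOpen_ball.mem_nhds hz] with y hy
  exact fDelta_eq hδ hy

theorem analyticAt_fDelta {δ : ℝ} (hδ : δ ≠ 0) : AnalyticAt ℂ (fDelta δ) 0 :=
  analyticAt_of_differentiableOn fun _ hz =>
    (hasDerivAt_fDelta hδ hz).differentiableAt.differentiableWithinAt

/-- The jet of `f_δ'`. One order less is needed for `f_δ'` than for `f_δ`, so that `3`-jets suffice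
to find the fourth coefficient of `f_δ`. -/
theorem hasJet_fDeltaDeriv (δ : ℝ) :
    HasJet (fDeltaDeriv δ) 1 (2 * δ) (2 * δ ^ 2 + 1) (4 * (δ ^ 3 + 2 * δ) / 3) := by
  -- The jets of `log ((1 + z) / (1 - z))` and of `1 / (1 - z²)` exist by analyticity; they are
  -- found by comparing coefficients in the equations that define these functions.
  have hlogd : DifferentiableOn ℂ (fun z : ℂ => Complex.log ((1 + z) / (1 - z))) unitDisk := by
    intro z hz
    have h1 := one_sub_ne_zero_of_mem hz
    have hq : DifferentiableAt ℂ (fun z : ℂ => (1 + z) / (1 - z)) z := by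
      fun_prop (disch := assumption)
    exact (hq.clog (cayley_mem_slitPlane hz)).differentiableWithinAt
  have hlog := HasJet.of_analyticAt (analyticAt_of_differentiableOn hlogd)
  have hinvd : DifferentiableOn ℂ (fun z : ℂ => (1 - z ^ 2)⁻¹) unitDisk := by
    intro z hz
    have h3 := one_sub_sq_ne_zero_of_mem hz
    apply DifferentiableAt.differentiableWithinAt
    fun_prop (disch := assumption)
  have hinv := HasJet.of_analyticAt (analyticAt_of_differentiableOn hinvd)
  generalize taylorCoeff (fun z : ℂ => (1 - z ^ 2)⁻¹) 0 = b0 at *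
  generalize taylorCoeff (fun z : ℂ => (1 - z ^ 2)⁻¹) 1 = b1 at *
  generalize taylorCoeff (fun z : ℂ => (1 - z ^ 2)⁻¹) 2 = b2 at *
  generalize taylorCoeff (fun z : ℂ => (1 - z ^ 2)⁻¹) 3 = b3 at *
  rw [taylorCoeff_zero] at hlog
  simp only [add_zero, sub_zero, div_one, Complex.log_one] at hlog
  generalize taylorCoeff (fun z : ℂ => Complex.log ((1 + z) / (1 - z))) 1 = q1 at *
  generalize taylorCoeff (fun z : ℂ => Complex.log ((1 + z) / (1 - z))) 2 = q2 at *
  generalize taylorCoeff (fun z : ℂ => Complex.log ((1 + z) / (1 - z))) 3 = q3 at *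
  have e1 := (((HasJet.of_cubic (f := fun z => 1 - z ^ 2) 1 0 (-1) 0 fun z => by ring).mul
    hinv).congr (g := fun _ => 1) (by
      filter_upwards [unitDisk_mem_nhds] with z hz
      exact mul_inv_cancel₀ (one_sub_sq_ne_zero_of_mem hz))).unique (HasJet.const 1)
  have e2 := (((HasJet.of_cubic (f := fun z => 1 - z) 1 (-1) 0 0 fun z => by ring).mul
    hlog.cexp).congr (g := fun z => 1 + z) (by
      filter_upwards [unitDisk_mem_nhds] with z hz
      rw [Complex.exp_log (Complex.slitPlane_ne_zero (cayley_mem_slitPlane hz)),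
        mul_div_cancel₀ _ (one_sub_ne_zero_of_mem hz)])).unique
    (HasJet.of_cubic 1 1 0 0 fun z => by ring)
  obtain ⟨e10, e11, e12, e13⟩ := e1
  obtain ⟨-, e21, e22, e23⟩ := e2
  have hb0 : b0 = 1 := by linear_combination e10
  have hb1 : b1 = 0 := by linear_combination e11
  have hb2 : b2 = 1 := by linear_combination e12 + hb0
  have hb3 : b3 = 0 := by linear_combination e13 + hb1
  have hq1 : q1 = 2 := by linear_combination e21
  subst hb0 hb1 hb2 hb3 hq1
  have hq2 : q2 = 0 := by linear_combination e22
  subst hq2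
  have hq3 : q3 = 2 / 3 := by linear_combination e23
  subst hq3
  have h := ((hlog.const_mul (δ : ℂ)))
  rw [mul_zero] at h
  have h' := (h.cexp.mul hinv).congr (g := fDeltaDeriv δ) (by
    filter_upwards [unitDisk_mem_nhds] with z hz
    rw [fDeltaDeriv, Complex.cpow_def_of_ne_zero
      (Complex.slitPlane_ne_zero (cayley_mem_slitPlane hz)), div_eq_mul_inv _ (1 - z ^ 2),
      mul_comm (δ : ℂ)])
  convert h' using 1 <;> ring

/-- The coefficients `b₂, b₃, b₄` of `f_δ`. -/
theorem taylorCoeff_fDelta {δ : ℝ} (hδ : δ ≠ 0) :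
    taylorCoeff (fDelta δ) 2 = δ ∧ taylorCoeff (fDelta δ) 3 = (2 * δ ^ 2 + 1) / 3 ∧
      taylorCoeff (fDelta δ) 4 = (δ ^ 3 + 2 * δ) / 3 := by
  have hev : deriv (fDelta δ) =ᶠ[𝓝 0] fDeltaDeriv δ := by
    filter_upwards [unitDisk_mem_nhds] with z hz
    exact (hasDerivAt_fDelta hδ hz).deriv
  obtain ⟨-, h1, h2, h3⟩ := ((HasJet.of_analyticAt (analyticAt_fDelta hδ).deriv).congr hev).unique
    (hasJet_fDeltaDeriv δ)
  rw [taylorCoeff_deriv] at h1 h2 h3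
  norm_num at h1 h2 h3
  refine ⟨?_, ?_, ?_⟩
  · exact h1
  · linear_combination h2 / 3
  · linear_combination h3 / 4

/-! ### Coefficients of Schwarz functions -/

theorem norm_sub_le_norm_one_sub_conj_mul {a b : ℂ} (ha : ‖a‖ ≤ 1) (hb : ‖b‖ ≤ 1) :
    ‖b - a‖ ≤ ‖1 - conj a * b‖ := by
  have ha' : Complex.normSq a ≤ 1 := by
    rw [Complex.normSq_eq_norm_sq]; nlinarith [norm_nonneg a]
  have hb' : Complex.normSq b ≤ 1 := by
    rw [Complex.normSq_eq_norm_sq]; nlinarith [norm_nonneg b]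
  rw [← sq_le_sq₀ (norm_nonneg _) (norm_nonneg _), Complex.sq_norm, Complex.sq_norm]
  have h := mul_nonneg (sub_nonneg.mpr ha') (sub_nonneg.mpr hb')
  simp only [Complex.normSq_apply, Complex.sub_re, Complex.sub_im, Complex.mul_re, Complex.mul_im,
    Complex.conj_re, Complex.conj_im, Complex.one_re, Complex.one_im] at h ⊢
  linarith

theorem one_sub_conj_mul_ne_zero {a b : ℂ} (ha : ‖a‖ < 1) (hb : ‖b‖ ≤ 1) : 1 - conj a * b ≠ 0 := by
  intro h
  have h1 : ‖conj a * b‖ = 1 := by rw [← sub_eq_zero.mp h]; simp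
  rw [norm_mul, Complex.norm_conj] at h1
  nlinarith [norm_nonneg a, norm_nonneg b]

/-- A function vanishing at the origin and bounded by `1` in the unit disk is `z` times another
function bounded by `1`. -/
theorem exists_eq_id_mul {w : ℂ → ℂ} (hd : DifferentiableOn ℂ w unitDisk) (h0 : w 0 = 0)
    (hb : ∀ z ∈ unitDisk, ‖w z‖ ≤ 1) :
    ∃ g : ℂ → ℂ, DifferentiableOn ℂ g unitDisk ∧ (∀ z ∈ unitDisk, ‖g z‖ ≤ 1) ∧
      ∀ z, w z = z * g z := by
  refine ⟨dslope w 0, (Complex.differentiableOn_dslope unitDisk_mem_nhds).mpr hd, fun z hz => ?_,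
    fun z => ?_⟩
  · simpa using Complex.norm_dslope_le_div_of_mapsTo_ball (R₂ := 1) hd
      (fun z hz => by simpa [h0] using hb z hz) hz
  · have := sub_smul_dslope w 0 z
    simpa [h0] using this.symm

/-- One step of the Schur algorithm: `(g - g(0)) / (1 - conj (g(0)) g)` is again bounded by `1`, and
it vanishes at the origin. -/
theorem exists_schur_step {g : ℂ → ℂ} (hd : DifferentiableOn ℂ g unitDisk)
    (hb : ∀ z ∈ unitDisk, ‖g z‖ ≤ 1) (h0 : ‖g 0‖ < 1) :
    ∃ G : ℂ → ℂ, DifferentiableOn ℂ G unitDisk ∧ (∀ z ∈ unitDisk, ‖G z‖ ≤ 1) ∧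
      ∀ z ∈ unitDisk, g z = g 0 + z * G z * (1 - conj (g 0) * g z) := by
  have hne : ∀ z ∈ unitDisk, 1 - conj (g 0) * g z ≠ 0 := fun z hz =>
    one_sub_conj_mul_ne_zero h0 (hb z hz)
  obtain ⟨G, hGd, hGb, hG⟩ := exists_eq_id_mul
    (w := fun z => (g z - g 0) / (1 - conj (g 0) * g z))
    ((hd.sub_const _).div ((hd.const_mul _).const_sub _) hne) (by simp) (fun z hz => by
      rw [norm_div]
      exact div_le_one_of_le₀ (norm_sub_le_norm_one_sub_conj_mul h0.le (hb z hz)) (norm_nonneg _))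
  refine ⟨G, hGd, hGb, fun z hz => ?_⟩
  rw [← hG, div_mul_cancel₀ _ (hne z hz)]
  ring

/-- The coefficient form of a Schur step. If `|g(0)| = 1`, the maximum principle makes `g`
constant. -/
theorem schur_coeff {g : ℂ → ℂ} (hd : DifferentiableOn ℂ g unitDisk)
    (hb : ∀ z ∈ unitDisk, ‖g z‖ ≤ 1) {a b c d : ℂ} (hj : HasJet g a b c d) :
    ‖a‖ ≤ 1 ∧ (‖a‖ = 1 → b = 0 ∧ c = 0) ∧ (‖a‖ < 1 →
      ∃ (G : ℂ → ℂ) (x y x' y' : ℂ), DifferentiableOn ℂ G unitDisk ∧ (∀ z ∈ unitDisk, ‖G z‖ ≤ 1) ∧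
        HasJet G x y x' y' ∧ b = (1 - ‖a‖ ^ 2) * x ∧
        c = (1 - ‖a‖ ^ 2) * y - conj a * x * b) := by
  have ha : g 0 = a := by
    have := (HasJet.of_analyticAt (analyticAt_of_differentiableOn hd)).unique hj
    rw [← taylorCoeff_zero g]; exact this.1
  have hconj : (‖a‖ ^ 2 : ℂ) = conj a * a := by
    rw [← Complex.normSq_eq_conj_mul_self, Complex.normSq_eq_norm_sq]; push_cast; rfl
  refine ⟨ha ▸ hb 0 zero_mem_unitDisk, fun h1 => ?_, fun h1 => ?_⟩
  · have hconst : ∀ z ∈ unitDisk, g z = g 0 := by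
      intro z hz
      have := Complex.eqOn_of_isPreconnected_of_isMaxOn_norm (convex_ball (0 : ℂ) 1).isPreconnected
        Metric.isOpen_ball hd zero_mem_unitDisk (fun y hy => by
          simpa [ha, h1] using hb y hy)
      exact this hz
    have := (hj.congr (g := fun _ => g 0) (by
      filter_upwards [unitDisk_mem_nhds] with z hz using hconst z hz)).unique (HasJet.const _)
    exact ⟨this.2.1, this.2.2.1⟩
  · obtain ⟨G, hGd, hGb, hG⟩ := exists_schur_step hd hb (by rwa [ha])
    have hGj := HasJet.of_analyticAt (analyticAt_of_differentiableOn hGd)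
    refine ⟨G, _, _, _, _, hGd, hGb, hGj, ?_⟩
    have h2 := ((HasJet.const a).add (hGj.id_mul.mul ((HasJet.const 1).add
      (hj.const_mul (-conj a))))).congr (g := g) (by
        filter_upwards [unitDisk_mem_nhds] with z hz
        conv_rhs => rw [hG z hz]
        rw [ha]; ring)
    obtain ⟨-, e1, e2, -⟩ := h2.unique hj
    rw [hconj]
    constructor
    · linear_combination -e1
    · linear_combination -e2

/-- The Schwarz–Pick inequality at the origin. -/
theorem norm_coeff_one_le {g : ℂ → ℂ} (hd : DifferentiableOn ℂ g unitDisk)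
    (hb : ∀ z ∈ unitDisk, ‖g z‖ ≤ 1) {a b c d : ℂ} (hj : HasJet g a b c d) :
    ‖b‖ ≤ 1 - ‖a‖ ^ 2 := by
  obtain ⟨h1, h2, h3⟩ := schur_coeff hd hb hj
  rcases h1.eq_or_lt with h | h
  · simp [(h2 h).1, h]
  · obtain ⟨G, x, y, x', y', hGd, hGb, hGj, hx, -⟩ := h3 h
    have h4 := (schur_coeff hGd hGb hGj).1
    have h5 : 0 ≤ 1 - ‖a‖ ^ 2 := by nlinarith [norm_nonneg a]
    have h6 : ((1 : ℂ) - (‖a‖ : ℂ) ^ 2) = ((1 - ‖a‖ ^ 2 : ℝ) : ℂ) := by push_cast; rfl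
    rw [hx, h6, norm_mul, Complex.norm_real, Real.norm_of_nonneg h5]
    exact mul_le_of_le_one_right h5 h4

/-- The modulus bounds satisfied by the first three coefficients `p₁, p₂, p₃` of a Schwarz function;
`ξ` is the modulus of its second Schur parameter. -/
def SchwarzBounds (p₁ p₂ p₃ : ℂ) : Prop :=
  ‖p₁‖ ≤ 1 ∧ ∃ ξ : ℝ, 0 ≤ ξ ∧ ξ ≤ 1 ∧ ‖p₂‖ ≤ (1 - ‖p₁‖ ^ 2) * ξ ∧
    ‖p₃‖ ≤ (1 - ‖p₁‖ ^ 2) * (1 - ξ ^ 2 + ‖p₁‖ * ξ ^ 2)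

/-- Two steps of the Schur algorithm: with Schur parameters `p₁, x, ζ` one has
`p₂ = (1 - |p₁|²) x` and `p₃ = (1 - |p₁|²) ((1 - |x|²) ζ - conj p₁ x²)`. -/
theorem schwarz_coeff_bounds {w : ℂ → ℂ} (hd : DifferentiableOn ℂ w unitDisk) (h0 : w 0 = 0)
    (hb : ∀ z ∈ unitDisk, ‖w z‖ ≤ 1) {p₁ p₂ p₃ : ℂ} (hj : HasJet w 0 p₁ p₂ p₃) :
    SchwarzBounds p₁ p₂ p₃ := by
  obtain ⟨g, hgd, hgb, hg⟩ := exists_eq_id_mul hd h0 hb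
  have hgj := HasJet.of_analyticAt (analyticAt_of_differentiableOn hgd)
  obtain ⟨-, e1, e2, e3⟩ := (hgj.id_mul.congr (g := w)
    (Eventually.of_forall fun z => (hg z).symm)).unique hj
  rw [e1, e2, e3] at hgj
  obtain ⟨h1, h2, h3⟩ := schur_coeff hgd hgb hgj
  refine ⟨h1, ?_⟩
  rcases h1.eq_or_lt with h | h
  · exact ⟨0, le_rfl, zero_le_one, by simp [(h2 h).1], by simp [(h2 h).2, h]⟩
  · obtain ⟨G, x, y, x', y', hGd, hGb, hGj, hx, hy⟩ := h3 h
    have hx1 := (schur_coeff hGd hGb hGj).1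
    have hy1 := norm_coeff_one_le hGd hGb hGj
    have h5 : 0 ≤ 1 - ‖p₁‖ ^ 2 := by nlinarith [norm_nonneg p₁]
    have h6 : ((1 : ℂ) - (‖p₁‖ : ℂ) ^ 2) = ((1 - ‖p₁‖ ^ 2 : ℝ) : ℂ) := by push_cast; rfl
    have h7 : ‖p₂‖ = (1 - ‖p₁‖ ^ 2) * ‖x‖ := by
      rw [hx, h6, norm_mul, Complex.norm_real, Real.norm_of_nonneg h5]
    refine ⟨‖x‖, norm_nonneg _, hx1, h7.le, ?_⟩
    rw [hy, h6]
    refine (norm_sub_le _ _).trans ?_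
    rw [norm_mul, norm_mul, norm_mul, Complex.norm_conj, h7, Complex.norm_real,
      Real.norm_of_nonneg h5]
    have := mul_le_mul_of_nonneg_left hy1 h5
    nlinarith

/-! ### Coefficient form of the subordinations -/

theorem hasJet_chebyshevG (t : ℝ) :
    HasJet (chebyshevG t) 1 (2 * t) (4 * t ^ 2 - 1) (8 * t ^ 3 - 4 * t) := by
  have hne : (1 - 2 * (t : ℂ) * 0 + 0 ^ 2) ≠ 0 := by norm_num
  have hd : AnalyticAt ℂ (chebyshevG t) 0 := by
    unfold chebyshevG
    exact AnalyticAt.div (by fun_prop) (by fun_prop) hne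
  have hj := HasJet.of_analyticAt hd
  have hc : ContinuousAt (fun z : ℂ => 1 - 2 * (t : ℂ) * z + z ^ 2) 0 := by fun_prop
  obtain ⟨e0, e1, e2, e3⟩ := (((HasJet.of_cubic (f := fun z => 1 - 2 * (t : ℂ) * z + z ^ 2)
    1 (-2 * t) 1 0 fun z => by ring).mul hj).congr (g := fun _ => 1) (by
      filter_upwards [hc.eventually_ne hne] with z hz
      exact mul_one_div_cancel hz)).unique (HasJet.const 1)
  rw [one_mul] at e0
  rw [e0] at e1 e2 e3 hj
  have h1 : taylorCoeff (chebyshevG t) 1 = 2 * t := by linear_combination e1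
  rw [h1] at e2 e3 hj
  have h2 : taylorCoeff (chebyshevG t) 2 = 4 * t ^ 2 - 1 := by linear_combination e2
  rw [h2] at e3 hj
  have h3 : taylorCoeff (chebyshevG t) 3 = 8 * t ^ 3 - 4 * t := by linear_combination e3
  rwa [h3] at hj

/-- In terms of the logarithm `L` of `h(z) / z`, the Bazilevič expression is
`exp (μ L) (1 + l z L')`. -/
theorem bazilevic_eq {l μ : ℝ} {h L : ℂ → ℂ} (hL : IsLogBranch h L) {z : ℂ} (hz : z ∈ unitDisk) :
    bazilevic l μ h L z = Complex.exp (μ * L z) * (1 + l * (z * deriv L z)) := by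
  obtain ⟨hLd, -, hLe⟩ := hL
  have hLz : HasDerivAt L (deriv L z) z :=
    (hLd.differentiableAt (Metric.isOpen_ball.mem_nhds hz)).hasDerivAt
  have hh : deriv h z = Complex.exp (L z) + z * (Complex.exp (L z) * deriv L z) := by
    have h1 : h =ᶠ[𝓝 z] fun z => z * Complex.exp (L z) := by
      filter_upwards [Metric.isOpen_ball.mem_nhds hz] with y hy using hLe y hy
    rw [h1.deriv_eq]
    simpa using ((hasDerivAt_id' z).fun_mul hLz.cexp).deriv
  have he : Complex.exp (μ * L z) = Complex.exp (L z) * Complex.exp ((μ - 1) * L z) := by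
    rw [← Complex.exp_add]; ring_nf
  rw [bazilevic, hh, he]
  ring

/-- The subordination, compared coefficient by coefficient. -/
theorem coeff_of_subordinate {l μ t : ℝ} {h L : ℂ → ℂ} (hL : IsLogBranch h L)
    (hs : Subordinate (bazilevic l μ h L) (chebyshevG t)) {l₁ l₂ l₃ : ℂ}
    (hj : HasJet L 0 l₁ l₂ l₃) :
    ∃ p₁ p₂ p₃ : ℂ, SchwarzBounds p₁ p₂ p₃ ∧ (l + μ) * l₁ = 2 * t * p₁ ∧
      (2 * l + μ) * (l₂ + μ * l₁ ^ 2 / 2) = 2 * t * p₂ + (4 * t ^ 2 - 1) * p₁ ^ 2 ∧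
      (3 * l + μ) * (l₃ + μ * l₁ * l₂ + μ ^ 2 * l₁ ^ 3 / 6) =
        2 * t * p₃ + 2 * (4 * t ^ 2 - 1) * p₁ * p₂ + (8 * t ^ 3 - 4 * t) * p₁ ^ 3 := by
  obtain ⟨w, hwd, hw0, hwb, hw⟩ := hs
  have hwj := HasJet.of_analyticAt (analyticAt_of_differentiableOn hwd)
  rw [taylorCoeff_zero, hw0] at hwj
  have hLa := analyticAt_of_differentiableOn hL.1
  have hLj := HasJet.of_analyticAt hLa
  obtain ⟨-, e1, e2, e3⟩ := hLj.unique hj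
  have hLj' := HasJet.of_analyticAt hLa.deriv
  simp only [taylorCoeff_deriv] at hLj'
  norm_num [e1, e2, e3] at hLj'
  refine ⟨_, _, _, schwarz_coeff_bounds hwd hw0 (fun z hz => (hwb z hz).le) hwj, ?_⟩
  have h1 := (hj.const_mul (μ : ℂ))
  rw [mul_zero] at h1
  have h2 := (h1.cexp.mul ((HasJet.const 1).add (hLj'.id_mul.const_mul (l : ℂ)))).congr
    (g := fun z => chebyshevG t (w z)) (by
      filter_upwards [unitDisk_mem_nhds] with z hz
      rw [← hw z hz, bazilevic_eq hL hz])
  obtain ⟨-, f1, f2, f3⟩ := h2.unique ((hasJet_chebyshevG t).comp hwj)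
  refine ⟨?_, ?_, ?_⟩
  · linear_combination f1
  · linear_combination f2
  · linear_combination f3

/-- The coefficients of `log (k(w) / w)` for the inverse function `k` of `h`, in terms of those of
`log (h(z) / z)`: they follow from `L + M ∘ h = 0` near the origin, which is `k (h z) = z`. -/
theorem inverse_log_coeff {h k L M : ℂ → ℂ} (hL : IsLogBranch h L) (hM : IsLogBranch k M)
    (hk : ∀ᶠ z in 𝓝 (0 : ℂ), k (h z) = z) {l₁ l₂ l₃ m₁ m₂ m₃ : ℂ}
    (hLj : HasJet L 0 l₁ l₂ l₃) (hMj : HasJet M 0 m₁ m₂ m₃) :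
    m₁ = -l₁ ∧ m₂ = -l₂ + l₁ ^ 2 ∧
      m₃ = -l₃ + l₁ * (l₂ + l₁ ^ 2 / 2) - 2 * (-l₂ + l₁ ^ 2) * l₁ := by
  have hhj := hLj.cexp.id_mul.congr (g := h) (by
    filter_upwards [unitDisk_mem_nhds] with z hz using (hL.2.2 z hz).symm)
  have hN := hLj.add (hMj.comp hhj)
  rw [add_zero] at hN
  have hh : ∀ᶠ z in 𝓝 (0 : ℂ), h z ∈ unitDisk := hhj.tendsto.eventually unitDisk_mem_nhds
  have h1 : ∀ᶠ z in 𝓝 (0 : ℂ), Complex.exp (L z + M (h z)) = 1 := by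
    filter_upwards [hk, hh, unitDisk_mem_nhds] with z hz hhz hzd
    rcases eq_or_ne z 0 with rfl | hz0
    · rw [hL.2.2 _ hzd, zero_mul, hL.2.1, hM.2.1]
      simp
    · apply mul_left_cancel₀ hz0
      rw [Complex.exp_add, ← mul_assoc, ← hL.2.2 _ hzd, ← hM.2.2 _ hhz, hz, mul_one]
  obtain ⟨-, e1, e2, e3⟩ := (hN.cexp.congr h1).unique (HasJet.const 1)
  have f1 : m₁ = -l₁ := by linear_combination e1
  rw [e1] at e2 e3
  have f2 : m₂ = -l₂ + l₁ ^ 2 := by rw [f1] at e2; linear_combination e2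
  refine ⟨f1, f2, ?_⟩
  rw [f1, f2] at e3
  linear_combination e3

theorem taylorCoeff_of_logBranch {h L : ℂ → ℂ} (hL : IsLogBranch h L)
    (ha : AnalyticAt ℂ h 0) {l₁ l₂ l₃ : ℂ} (hj : HasJet L 0 l₁ l₂ l₃) :
    taylorCoeff h 2 = l₁ ∧ taylorCoeff h 3 = l₂ + l₁ ^ 2 / 2 ∧
      taylorCoeff h 4 = l₃ + l₁ * l₂ + l₁ ^ 3 / 6 := by
  have hE : AnalyticAt ℂ (fun z => Complex.exp (L z)) 0 :=
    (analyticAt_of_differentiableOn hL.1).cexp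
  have hs := taylorCoeff_of_eq_id_mul ha hE (by
    filter_upwards [unitDisk_mem_nhds] with z hz using hL.2.2 z hz)
  obtain ⟨-, e1, e2, e3⟩ := (HasJet.of_analyticAt hE).unique hj.cexp
  exact ⟨by rw [hs 1, e1], by rw [hs 2, e2], by rw [hs 3, e3]⟩

/-! ### The second Hankel determinant -/

theorem chebU_one (t : ℝ) : chebU 1 t = 2 * t := by simp [chebU]

theorem chebU_two (t : ℝ) : chebU 2 t = 4 * t ^ 2 - 1 := by
  simp [chebU, Polynomial.Chebyshev.U_two]

theorem chebU_three (t : ℝ) : chebU 3 t = 8 * t ^ 3 - 4 * t := by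
  have h := Polynomial.Chebyshev.U_add_two ℝ 1
  norm_num at h
  simp [chebU, h, Polynomial.Chebyshev.U_two]
  ring

/-- The second Hankel determinant in terms of the coefficients of the two Schwarz functions. Here
`s₁, s₂, s₃` stand for `l + μ`, `2l + μ`, `3l + μ`, and `u₁, u₂, u₃` for `U₁(t), U₂(t), U₃(t)`. -/
theorem hankel_eq {μ δ s₁ s₂ s₃ u₁ u₂ u₃ l₁ l₂ l₃ m₁ m₂ m₃ p₁ p₂ p₃ q₁ q₂ q₃ : ℂ}
    (hs₁ : s₁ ≠ 0) (hs₂ : s₂ ≠ 0) (hs₃ : s₃ ≠ 0) (hδ : δ ≠ 0) (hδ₃ : δ ^ 3 + 2 * δ ≠ 0)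
    (hδ₂ : 2 * δ ^ 2 + 1 ≠ 0) (hu : u₁ ≠ 0)
    (hp₁ : s₁ * l₁ = u₁ * p₁) (hp₂ : s₂ * (l₂ + μ * l₁ ^ 2 / 2) = u₁ * p₂ + u₂ * p₁ ^ 2)
    (hp₃ : s₃ * (l₃ + μ * l₁ * l₂ + μ ^ 2 * l₁ ^ 3 / 6) =
      u₁ * p₃ + 2 * u₂ * p₁ * p₂ + u₃ * p₁ ^ 3)
    (hq₁ : s₁ * m₁ = u₁ * q₁) (hq₂ : s₂ * (m₂ + μ * m₁ ^ 2 / 2) = u₁ * q₂ + u₂ * q₁ ^ 2)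
    (hq₃ : s₃ * (m₃ + μ * m₁ * m₂ + μ ^ 2 * m₁ ^ 3 / 6) =
      u₁ * q₃ + 2 * u₂ * q₁ * q₂ + u₃ * q₁ ^ 3)
    (hm₁ : m₁ = -l₁) (hm₂ : m₂ = -l₂ + l₁ ^ 2)
    (hm₃ : m₃ = -l₃ + l₁ * (l₂ + l₁ ^ 2 / 2) - 2 * (-l₂ + l₁ ^ 2) * l₁) :
    q₁ = -p₁ ∧
    l₁ / δ * (3 * (l₃ + l₁ * l₂ + l₁ ^ 3 / 6) / (δ ^ 3 + 2 * δ))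
        - (3 * (l₂ + l₁ ^ 2 / 2) / (2 * δ ^ 2 + 1)) ^ 2 =
      u₁ * (18 * (2 * δ ^ 2 + 1) ^ 2 * s₁ ^ 3 * u₃ - u₁ ^ 3 * s₃ *
          (3 * (2 * δ ^ 2 + 1) ^ 2 * (μ ^ 2 + 3 * μ - 4) + 54 * δ * (δ ^ 3 + 2 * δ))) /
          (6 * δ * (δ ^ 3 + 2 * δ) * (2 * δ ^ 2 + 1) ^ 2 * s₃ * s₁ ^ 4) * p₁ ^ 4
      + 3 * (8 * δ ^ 4 - 4 * δ ^ 2 + 5) * u₁ ^ 3 /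
          (4 * δ * (δ ^ 3 + 2 * δ) * (2 * δ ^ 2 + 1) ^ 2 * s₁ ^ 2 * s₂) * (p₁ ^ 2 * (p₂ - q₂))
      + 3 * u₁ * u₂ / (δ * (δ ^ 3 + 2 * δ) * s₁ * s₃) * (p₁ ^ 2 * (p₂ + q₂))
      + 3 * u₁ ^ 2 / (2 * δ * (δ ^ 3 + 2 * δ) * s₁ * s₃) * (p₁ * (p₃ - q₃))
      - 9 * u₁ ^ 2 / (4 * (2 * δ ^ 2 + 1) ^ 2 * s₂ ^ 2) * (p₂ - q₂) ^ 2 := by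
  have hq : q₁ = -p₁ := mul_left_cancel₀ hu (by rw [← hq₁, hm₁]; linear_combination -hp₁)
  refine ⟨hq, ?_⟩
  subst hm₁ hm₂ hm₃ hq
  have hl₁ : l₁ = u₁ * p₁ / s₁ := by field_simp; linear_combination hp₁
  -- `c₃ = c₂² + Δ`, where `cₙ` are the coefficients of `h`, and `c₂ = l₁`.
  have hl₂ : l₂ = l₁ ^ 2 / 2 + u₁ * (p₂ - q₂) / (2 * s₂) := by
    field_simp
    linear_combination hp₂ - hq₂
  -- The left-hand side is `c₄`, found by subtracting the third-order equations for `h` and `k`.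
  have hl₃ : l₃ + l₁ * l₂ + l₁ ^ 3 / 6 = 5 / 2 * l₁ * (u₁ * (p₂ - q₂) / (2 * s₂))
      - (μ ^ 2 + 3 * μ - 4) / 6 * l₁ ^ 3
      + (u₁ * (p₃ - q₃) / 2 + u₂ * p₁ * (p₂ + q₂) + u₃ * p₁ ^ 3) / s₃ := by
    have h1 : u₁ * (p₂ - q₂) / (2 * s₂) = l₂ - l₁ ^ 2 / 2 := by rw [hl₂]; ring
    rw [h1]
    field_simp
    linear_combination 12 * hp₃ - 12 * hq₃
  rw [hl₃, hl₂, hl₁, show 8 * δ ^ 4 - 4 * δ ^ 2 + 5 =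
    5 * (2 * δ ^ 2 + 1) ^ 2 - 12 * δ * (δ ^ 3 + 2 * δ) by ring]
  generalize 2 * δ ^ 2 + 1 = v at *
  generalize δ ^ 3 + 2 * δ = e at *
  field_simp
  ring

/-- The triangle inequality bound is largest when both second Schur parameters have modulus `1`;
this uses `K₃ ≤ 4 K₄`. -/
theorem bound_le_of_schur_params {K₁ K₂ K₃ K₄ r x y : ℝ} (hK₁ : 0 ≤ K₁) (hK₂ : 0 ≤ K₂)
    (hK₃ : 0 ≤ K₃) (hK : K₃ ≤ 4 * K₄) (hr : 0 ≤ r) (hr1 : r ≤ 1) (hx : 0 ≤ x) (hx1 : x ≤ 1)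
    (hy : 0 ≤ y) (hy1 : y ≤ 1) :
    (K₁ + K₂) * (r ^ 2 * ((1 - r ^ 2) * (x + y)))
      + K₃ * (r * ((1 - r ^ 2) * (1 - x ^ 2 + r * x ^ 2 + (1 - y ^ 2 + r * y ^ 2))))
      + K₄ * ((1 - r ^ 2) * (x + y)) ^ 2 ≤
    2 * (K₁ + K₂ + K₃) * (r ^ 2 * (1 - r ^ 2)) + 4 * K₄ * (1 - r ^ 2) ^ 2 := by
  have hs : 0 ≤ 1 - r ^ 2 := by nlinarith
  have hv : 0 ≤ 2 - x ^ 2 - y ^ 2 := by nlinarith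
  have h1 : 0 ≤ (K₁ + K₂) * (r ^ 2 * (1 - r ^ 2)) * (2 - x - y) := by
    have : 0 ≤ 2 - x - y := by linarith
    positivity
  have h2 : 0 ≤ K₄ * (1 - r ^ 2) ^ 2 * (x - y) ^ 2 := by
    have : 0 ≤ K₄ := by linarith
    positivity
  have h3 : 0 ≤ 2 * K₄ * (1 + r) - K₃ * r := by nlinarith
  have h4 : 0 ≤ (1 - r) * (1 - r ^ 2) * (2 - x ^ 2 - y ^ 2) * (2 * K₄ * (1 + r) - K₃ * r) := by
    have : 0 ≤ 1 - r := by linarith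
    positivity
  linear_combination h1 + h2 + h4

/-- The estimate of the second Hankel determinant as a quadratic polynomial in `s = |p₁|²`. -/
theorem bound_eq_quadratic {s₁ s₂ s₃ δ u₁ u₂ W s : ℝ} (hs₁ : 0 < s₁) (hs₂ : 0 < s₂) (hs₃ : 0 < s₃)
    (hδ : 0 < δ) :
    u₁ * W / (6 * δ * (δ ^ 3 + 2 * δ) * (2 * δ ^ 2 + 1) ^ 2 * s₃ * s₁ ^ 4) * s ^ 2
      + (2 * (3 * (8 * δ ^ 4 - 4 * δ ^ 2 + 5) * u₁ ^ 3 /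
            (4 * δ * (δ ^ 3 + 2 * δ) * (2 * δ ^ 2 + 1) ^ 2 * s₁ ^ 2 * s₂)
          + 3 * u₁ * u₂ / (δ * (δ ^ 3 + 2 * δ) * s₁ * s₃)
          + 3 * u₁ ^ 2 / (2 * δ * (δ ^ 3 + 2 * δ) * s₁ * s₃)) * (s * (1 - s))
        + 4 * (9 * u₁ ^ 2 / (4 * (2 * δ ^ 2 + 1) ^ 2 * s₂ ^ 2)) * (1 - s) ^ 2) =
    9 * u₁ ^ 2 / ((2 * δ ^ 2 + 1) ^ 2 * s₂ ^ 2)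
      + ((s₂ ^ 2 * u₁ * W
            + 18 * s₁ ^ 3 * (3 * δ * (δ ^ 3 + 2 * δ) * s₁ * s₃ - (2 * δ ^ 2 + 1) ^ 2 * s₂ ^ 2)
              * u₁ ^ 2
            - 9 * s₁ ^ 2 * s₂ * u₁ * (s₃ * (8 * δ ^ 4 - 4 * δ ^ 2 + 5) * u₁ ^ 2
              + 4 * (2 * δ ^ 2 + 1) ^ 2 * s₂ * s₁ * u₂)) * s ^ 2
          + 9 * ((s₂ * s₃ * (8 * δ ^ 4 - 4 * δ ^ 2 + 5) * u₁ ^ 3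
            + 4 * (2 * δ ^ 2 + 1) ^ 2 * s₁ * s₂ ^ 2 * u₁ * u₂
            + s₁ * u₁ ^ 2 * (2 * (2 * δ ^ 2 + 1) ^ 2 * s₂ ^ 2
              - 12 * δ * (δ ^ 3 + 2 * δ) * s₁ * s₃)) * s₁ ^ 2) * s) /
        (6 * δ * (δ ^ 3 + 2 * δ) * (2 * δ ^ 2 + 1) ^ 2 * s₃ * s₂ ^ 2 * s₁ ^ 4) := by
  have : δ ^ 3 + 2 * δ ≠ 0 := by positivity
  have : 2 * δ ^ 2 + 1 ≠ 0 := by positivity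
  field_simp
  ring

/-- The triangle inequality for the expression in `hankel_eq`. -/
theorem norm_combination_le {T K₁ K₂ K₃ K₄ : ℝ} (hK₁ : 0 ≤ K₁) (hK₂ : 0 ≤ K₂) (hK₃ : 0 ≤ K₃)
    (hK : K₃ ≤ 4 * K₄) {p₁ p₂ p₃ q₂ q₃ : ℂ} (hp : SchwarzBounds p₁ p₂ p₃)
    (hq : SchwarzBounds (-p₁) q₂ q₃) :
    ‖T * p₁ ^ 4 + K₁ * (p₁ ^ 2 * (p₂ - q₂)) + K₂ * (p₁ ^ 2 * (p₂ + q₂))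
      + K₃ * (p₁ * (p₃ - q₃)) - K₄ * (p₂ - q₂) ^ 2‖ ≤
    |T| * (‖p₁‖ ^ 2) ^ 2 + (2 * (K₁ + K₂ + K₃) * (‖p₁‖ ^ 2 * (1 - ‖p₁‖ ^ 2))
      + 4 * K₄ * (1 - ‖p₁‖ ^ 2) ^ 2) := by
  obtain ⟨hr1, x, hx, hx1, hp₂, hp₃⟩ := hp
  obtain ⟨-, y, hy, hy1, hq₂, hq₃⟩ := hq
  rw [norm_neg] at hq₂ hq₃
  have hr := norm_nonneg p₁
  have hK₄ : 0 ≤ K₄ := by linarith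
  have hsub : ‖p₂ - q₂‖ ≤ (1 - ‖p₁‖ ^ 2) * (x + y) := (norm_sub_le _ _).trans (by linarith)
  have hadd : ‖p₂ + q₂‖ ≤ (1 - ‖p₁‖ ^ 2) * (x + y) := (norm_add_le _ _).trans (by linarith)
  have hsub₃ : ‖p₃ - q₃‖ ≤ (1 - ‖p₁‖ ^ 2) *
      (1 - x ^ 2 + ‖p₁‖ * x ^ 2 + (1 - y ^ 2 + ‖p₁‖ * y ^ 2)) :=
    (norm_sub_le _ _).trans (by linarith)
  refine le_trans ?_ (add_le_add_right
    (bound_le_of_schur_params hK₁ hK₂ hK₃ hK hr hr1 hx hx1 hy hy1) _)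
  have h0 : ‖(T : ℂ) * p₁ ^ 4‖ = |T| * (‖p₁‖ ^ 2) ^ 2 := by
    rw [norm_mul, norm_pow, Complex.norm_real, Real.norm_eq_abs]; ring
  have hre : ∀ {K : ℝ} (_ : 0 ≤ K) (w : ℂ), ‖(K : ℂ) * w‖ = K * ‖w‖ := fun hK w => by
    rw [norm_mul, Complex.norm_real, Real.norm_of_nonneg hK]
  have h1 : ‖(K₁ : ℂ) * (p₁ ^ 2 * (p₂ - q₂))‖ ≤ K₁ * (‖p₁‖ ^ 2 * ((1 - ‖p₁‖ ^ 2) * (x + y))) := by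
    rw [hre hK₁, norm_mul, norm_pow]; gcongr
  have h2 : ‖(K₂ : ℂ) * (p₁ ^ 2 * (p₂ + q₂))‖ ≤ K₂ * (‖p₁‖ ^ 2 * ((1 - ‖p₁‖ ^ 2) * (x + y))) := by
    rw [hre hK₂, norm_mul, norm_pow]; gcongr
  have h3 : ‖(K₃ : ℂ) * (p₁ * (p₃ - q₃))‖ ≤ K₃ * (‖p₁‖ * ((1 - ‖p₁‖ ^ 2) *
      (1 - x ^ 2 + ‖p₁‖ * x ^ 2 + (1 - y ^ 2 + ‖p₁‖ * y ^ 2)))) := by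
    rw [hre hK₃, norm_mul]; gcongr
  have h4 : ‖(K₄ : ℂ) * (p₂ - q₂) ^ 2‖ ≤ K₄ * ((1 - ‖p₁‖ ^ 2) * (x + y)) ^ 2 := by
    rw [hre hK₄, norm_pow]; gcongr
  refine (norm_sub_le _ _).trans ?_
  refine (add_le_add_left ((norm_add_le _ _).trans (add_le_add_left ((norm_add_le _ _).trans
    (add_le_add_left (norm_add_le _ _) _)) _)) _).trans ?_
  linarith

/-- The Hankel determinant is bounded by a quadratic polynomial in `s = |p₁|² ∈ [0, 1]`; the four
cases of the final estimate are the possible positions of its maximum. -/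
theorem hankel_bound (l μ δ t : ℝ) (hl : 1 ≤ l) (hμ : 0 ≤ μ) (hδ : 1 ≤ δ)
    (ht : 1 / 2 < t) {f h : ℂ → ℂ} (hf : f ∈ classA)
    (hfh : ∀ z ∈ unitDisk, h z = hadamard f (fDelta δ) z) (hh : h ∈ classN μ δ l t) :
    ∃ s : ℝ, 0 ≤ s ∧ s ≤ 1 ∧
      ‖taylorCoeff f 2 * taylorCoeff f 4 - taylorCoeff f 3 ^ 2‖ ≤
        9 * chebU 1 t ^ 2 / ((2 * δ ^ 2 + 1) ^ 2 * (2 * l + μ) ^ 2)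
          + (chi1 l μ δ t * s ^ 2 + 9 * chi2 l μ δ t * s) /
            (6 * δ * (δ ^ 3 + 2 * δ) * (2 * δ ^ 2 + 1) ^ 2 * (3 * l + μ) * (2 * l + μ) ^ 2
              * (l + μ) ^ 4) := by
  obtain ⟨⟨⟨hhd, -, -⟩, -, -⟩, -, ⟨L, hL, hLs⟩, k, ⟨-, -, hk⟩, M, hM, hMs⟩ := hh
  have hLj := HasJet.of_analyticAt (analyticAt_of_differentiableOn hL.1)
  have hMj := HasJet.of_analyticAt (analyticAt_of_differentiableOn hM.1)
  rw [taylorCoeff_zero, hL.2.1] at hLj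
  rw [taylorCoeff_zero, hM.2.1] at hMj
  obtain ⟨hm₁, hm₂, hm₃⟩ := inverse_log_coeff hL hM hk hLj hMj
  obtain ⟨hc₂, hc₃, hc₄⟩ := taylorCoeff_of_logBranch hL (analyticAt_of_differentiableOn hhd) hLj
  obtain ⟨p₁, p₂, p₃, hp, hp₁, hp₂, hp₃⟩ := coeff_of_subordinate hL hLs hLj
  obtain ⟨q₁, q₂, q₃, hq, hq₁, hq₂, hq₃⟩ := coeff_of_subordinate hM hMs hMj
  have hδ0 : 0 < δ := by linarith
  have hs₁ : 0 < l + μ := by linarith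
  have hs₂ : 0 < 2 * l + μ := by linarith
  have hs₃ : 0 < 3 * l + μ := by linarith
  have hδ₃ : 0 < δ ^ 3 + 2 * δ := by positivity
  have hδ₂ : 0 < 2 * δ ^ 2 + 1 := by positivity
  have hδ₃' : (δ : ℂ) ^ 3 + 2 * δ ≠ 0 := by exact_mod_cast hδ₃.ne'
  have hδ₂' : 2 * (δ : ℂ) ^ 2 + 1 ≠ 0 := by exact_mod_cast hδ₂.ne'
  have hδ0' : (δ : ℂ) ≠ 0 := by exact_mod_cast hδ0.ne'
  have hcoeff : ∀ n, taylorCoeff h n = taylorCoeff f n * taylorCoeff (fDelta δ) n := by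
    intro n
    rw [← taylorCoeff_hadamard (analyticAt_of_differentiableOn hf.1) (analyticAt_fDelta hδ0.ne')]
    have : h =ᶠ[𝓝 0] hadamard f (fDelta δ) := by
      filter_upwards [unitDisk_mem_nhds] with z hz using hfh z hz
    rw [taylorCoeff, taylorCoeff, this.iteratedDeriv_eq]
  obtain ⟨hb₂, hb₃, hb₄⟩ := taylorCoeff_fDelta hδ0.ne'
  rw [hcoeff, hb₂] at hc₂
  rw [hcoeff, hb₃] at hc₃
  rw [hcoeff, hb₄] at hc₄
  have ha₂ : taylorCoeff f 2 = taylorCoeff L 1 / δ := by rw [← hc₂]; field_simp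
  have ha₃ : taylorCoeff f 3 =
      3 * (taylorCoeff L 2 + taylorCoeff L 1 ^ 2 / 2) / (2 * (δ : ℂ) ^ 2 + 1) := by
    rw [← hc₃]; field_simp
  have ha₄ : taylorCoeff f 4 = 3 * (taylorCoeff L 3 + taylorCoeff L 1 * taylorCoeff L 2
      + taylorCoeff L 1 ^ 3 / 6) / ((δ : ℂ) ^ 3 + 2 * δ) := by
    rw [← hc₄, eq_div_iff hδ₃']; ring
  obtain ⟨hqp, hH⟩ := hankel_eq (by exact_mod_cast hs₁.ne') (by exact_mod_cast hs₂.ne')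
    (by exact_mod_cast hs₃.ne') hδ0' hδ₃' hδ₂'
    (mul_ne_zero two_ne_zero (by exact_mod_cast (by linarith : (0 : ℝ) < t).ne'))
    hp₁ hp₂ hp₃ hq₁ hq₂ hq₃ hm₁ hm₂ hm₃
  rw [hqp] at hq
  have hu₁ : 0 < 2 * t := by linarith
  have hu₂ : 0 < 4 * t ^ 2 - 1 := by nlinarith
  have hδ₄ : 0 < 8 * δ ^ 4 - 4 * δ ^ 2 + 5 := by nlinarith [sq_nonneg (δ ^ 2 - 1)]
  -- `K₃ ≤ 4 K₄` follows from `3 s₂² ≤ 4 s₁ s₃` and, since `δ ≥ 1`, `(2δ² + 1)² ≤ 4 δ (δ³ + 2δ)`.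
  have hK : 3 * (2 * t) ^ 2 / (2 * δ * (δ ^ 3 + 2 * δ) * (l + μ) * (3 * l + μ)) ≤
      4 * (9 * (2 * t) ^ 2 / (4 * (2 * δ ^ 2 + 1) ^ 2 * (2 * l + μ) ^ 2)) := by
    have h1 : 3 * (2 * l + μ) ^ 2 ≤ 4 * ((l + μ) * (3 * l + μ)) := by nlinarith
    have h2 : (2 * δ ^ 2 + 1) ^ 2 ≤ 4 * (δ * (δ ^ 3 + 2 * δ)) := by nlinarith
    have h3 := mul_le_mul h2 h1 (by positivity) (by positivity)
    have h4 : 0 < δ * (δ ^ 3 + 2 * δ) * ((l + μ) * (3 * l + μ)) := by positivity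
    rw [← mul_div_assoc, div_le_div_iff₀ (by positivity) (by positivity)]
    have h5 : (2 * δ ^ 2 + 1) ^ 2 * (2 * l + μ) ^ 2 ≤
        6 * (δ * (δ ^ 3 + 2 * δ) * ((l + μ) * (3 * l + μ))) := by linarith
    have h6 := mul_le_mul_of_nonneg_left h5 (by positivity : 0 ≤ 12 * (2 * t) ^ 2)
    linarith
  have hmain := norm_combination_le
    (T := 2 * t * Omega l μ δ t /
      (6 * δ * (δ ^ 3 + 2 * δ) * (2 * δ ^ 2 + 1) ^ 2 * (3 * l + μ) * (l + μ) ^ 4))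
    (K₁ := 3 * (8 * δ ^ 4 - 4 * δ ^ 2 + 5) * (2 * t) ^ 3 /
      (4 * δ * (δ ^ 3 + 2 * δ) * (2 * δ ^ 2 + 1) ^ 2 * (l + μ) ^ 2 * (2 * l + μ)))
    (K₂ := 3 * (2 * t) * (4 * t ^ 2 - 1) / (δ * (δ ^ 3 + 2 * δ) * (l + μ) * (3 * l + μ)))
    (by positivity) (by positivity) (by positivity) hK hp hq
  refine ⟨‖p₁‖ ^ 2, by positivity, by nlinarith [hp.1, norm_nonneg p₁], ?_⟩
  rw [ha₂, ha₃, ha₄, hH]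
  rw [Omega, chebU_one, chebU_three] at hmain
  push_cast at hmain
  refine hmain.trans (le_of_eq ?_)
  rw [abs_div, abs_mul, abs_of_pos hu₁, abs_of_pos (by positivity : 0 < 6 * δ * (δ ^ 3 + 2 * δ) *
    (2 * δ ^ 2 + 1) ^ 2 * (3 * l + μ) * (l + μ) ^ 4), bound_eq_quadratic hs₁ hs₂ hs₃ hδ0]
  simp only [chi1, chi2, Omega, chebU_one, chebU_two, chebU_three]

end BiUnivalent


theorem theorem1 (l μ δ t : ℝ) (hl : 1 ≤ l) (hμ : 0 ≤ μ) (hδ : 1 ≤ δ)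
    (ht : 1 / 2 < t) (ht' : t ≤ 1)
    (f h : ℂ → ℂ) (hf : f ∈ BiUnivalent.classA)
    (hfh : ∀ z ∈ BiUnivalent.unitDisk,
      h z = BiUnivalent.hadamard f (BiUnivalent.fDelta δ) z)
    (hh : h ∈ BiUnivalent.classN μ δ l t)
    (a : ℕ → ℂ) (ha : ∀ n, a n = BiUnivalent.taylorCoeff f n) :
    (0 ≤ BiUnivalent.chi1 l μ δ t → 0 ≤ BiUnivalent.chi2 l μ δ t →
      ‖a 2 * a 4 - a 3 ^ 2‖ ≤ BiUnivalent.phiTwo l μ δ t) ∧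
    (BiUnivalent.chi1 l μ δ t ≤ 0 → BiUnivalent.chi2 l μ δ t ≤ 0 →
      ‖a 2 * a 4 - a 3 ^ 2‖ ≤ 36 * t ^ 2 / ((2 * δ ^ 2 + 1) ^ 2 * (2 * l + μ) ^ 2)) ∧
    (0 < BiUnivalent.chi1 l μ δ t → BiUnivalent.chi2 l μ δ t < 0 →
      ‖a 2 * a 4 - a 3 ^ 2‖ ≤
        max (36 * t ^ 2 / ((2 * δ ^ 2 + 1) ^ 2 * (2 * l + μ) ^ 2))
          (BiUnivalent.phiTwo l μ δ t)) ∧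
    (BiUnivalent.chi1 l μ δ t < 0 → 0 < BiUnivalent.chi2 l μ δ t →
      ‖a 2 * a 4 - a 3 ^ 2‖ ≤
        max (BiUnivalent.phiCrit l μ δ t) (BiUnivalent.phiTwo l μ δ t)) := by
  obtain ⟨s, hs0, hs1, hb⟩ := BiUnivalent.hankel_bound l μ δ t hl hμ hδ ht hf hfh hh
  rw [← ha, ← ha, ← ha] at hb
  have hK0 : 9 * BiUnivalent.chebU 1 t ^ 2 / ((2 * δ ^ 2 + 1) ^ 2 * (2 * l + μ) ^ 2) =
      36 * t ^ 2 / ((2 * δ ^ 2 + 1) ^ 2 * (2 * l + μ) ^ 2) := by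
    rw [BiUnivalent.chebU_one]; ring
  simp only [BiUnivalent.phiTwo, BiUnivalent.phiCrit]
  have hδ0 : 0 < δ := by linarith
  have hs₁ : 0 < l + μ := by linarith
  have hs₂ : 0 < 2 * l + μ := by linarith
  have hs₃ : 0 < 3 * l + μ := by linarith
  have hD : 0 < 6 * δ * (δ ^ 3 + 2 * δ) * (2 * δ ^ 2 + 1) ^ 2 * (3 * l + μ) * (2 * l + μ) ^ 2
      * (l + μ) ^ 4 := by positivity
  have hcrit : 27 * BiUnivalent.chi2 l μ δ t ^ 2 /
      (8 * BiUnivalent.chi1 l μ δ t * δ * (δ ^ 3 + 2 * δ) * (2 * δ ^ 2 + 1) ^ 2 * (3 * l + μ)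
        * (2 * l + μ) ^ 2 * (l + μ) ^ 4) =
      81 * BiUnivalent.chi2 l μ δ t ^ 2 / (4 * BiUnivalent.chi1 l μ δ t) /
        (6 * δ * (δ ^ 3 + 2 * δ) * (2 * δ ^ 2 + 1) ^ 2 * (3 * l + μ) * (2 * l + μ) ^ 2
          * (l + μ) ^ 4) := by
    rw [div_div]
    rw [show (4 * BiUnivalent.chi1 l μ δ t * (6 * δ * (δ ^ 3 + 2 * δ) * (2 * δ ^ 2 + 1) ^ 2 *
      (3 * l + μ) * (2 * l + μ) ^ 2 * (l + μ) ^ 4)) = 3 * (8 * BiUnivalent.chi1 l μ δ t * δ *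
      (δ ^ 3 + 2 * δ) * (2 * δ ^ 2 + 1) ^ 2 * (3 * l + μ) * (2 * l + μ) ^ 2 * (l + μ) ^ 4) by ring,
      show 81 * BiUnivalent.chi2 l μ δ t ^ 2 = 3 * (27 * BiUnivalent.chi2 l μ δ t ^ 2) by ring,
      mul_div_mul_left _ _ three_ne_zero]
  rw [hcrit, hK0]
  rw [hK0] at hb
  generalize BiUnivalent.chi1 l μ δ t = c₁ at *
  generalize BiUnivalent.chi2 l μ δ t = c₂ at *
  generalize 6 * δ * (δ ^ 3 + 2 * δ) * (2 * δ ^ 2 + 1) ^ 2 * (3 * l + μ) * (2 * l + μ) ^ 2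
      * (l + μ) ^ 4 = D at *
  generalize 36 * t ^ 2 / ((2 * δ ^ 2 + 1) ^ 2 * (2 * l + μ) ^ 2) = K at *
  refine ⟨fun h1 h2 => hb.trans ?_, fun h1 h2 => hb.trans ?_, fun h1 h2 => hb.trans ?_,
    fun h1 h2 => hb.trans (le_max_of_le_left ?_)⟩
  · refine add_le_add le_rfl (div_le_div_of_nonneg_right ?_ hD.le)
    have : s ^ 2 ≤ 1 := by nlinarith
    nlinarith
  · have : (c₁ * s ^ 2 + 9 * c₂ * s) / D ≤ 0 :=
      div_nonpos_of_nonpos_of_nonneg (by nlinarith [sq_nonneg s]) hD.le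
    linarith
  · -- The quadratic polynomial is convex, so it lies below its chord.
    have hconv : c₁ * s ^ 2 + 9 * c₂ * s ≤ s * (c₁ + 9 * c₂) := by
      nlinarith [mul_nonneg (mul_nonneg h1.le hs0) (sub_nonneg.mpr hs1)]
    rcases le_total (c₁ + 9 * c₂) 0 with h3 | h3
    · apply le_max_of_le_left
      have : (c₁ * s ^ 2 + 9 * c₂ * s) / D ≤ 0 :=
        div_nonpos_of_nonpos_of_nonneg (by nlinarith) hD.le
      linarith
    · apply le_max_of_le_right
      refine add_le_add le_rfl (div_le_div_of_nonneg_right ?_ hD.le)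
      nlinarith
  · rw [sub_eq_add_neg, ← neg_div]
    refine add_le_add le_rfl (div_le_div_of_nonneg_right ?_ hD.le)
    -- Completing the square at the vertex of the concave quadratic polynomial.
    rw [← div_neg, le_div_iff₀ (by linarith)]
    nlinarith [sq_nonneg (2 * c₁ * s + 9 * c₂)]
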